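/- Let $N_t,N_R,N_T\ge 1$ be integers and let $T,B>0$ with $\Delta_t=\frac1{2B}$ and $N_t=T/\Delta_t$. Let $s_1,\dots,s_{N_T}$ be random complex-valued $T$-periodic signals on $\mathbb R$ (periodic white Gaussian noise), i.e. the samples $s_k(l\Delta_t)$, $1\le k\le N_T$, $1\le l\le N_t$, are independent and $\mathcal{CN}(0,\frac1{N_T})$-distributed (real and imaginary parts independent, $N(0,\frac1{2N_T})$). For a spacing $d$ write $$\mathbf a_{d,N}(\beta)=\bigl(1,e^{2\pi i d\beta},\dots,e^{2\pi i d\beta(N-1)}\bigr)^T ,\qquad \mathbf a_T=\mathbf a_{d_T,N_T},\quad \mathbf a_R=\mathbf a_{d_R,N_R},$$ where either $d_T=\frac12,\ d_R=\frac{N_T}2$, or $d_T=\frac{N_R}2,\ d_R=\frac12$. Let $\mathbf S_\tau$ be the $N_t\times N_T$ matrix with entries $s_k(l\Delta_t-\tau)$ ($1\le l\le N_t$, $1\le k\le N_T$), and let $\mathbf Z(\beta,\tau)=\mathbf a_R(\beta)\,\mathbf a_T(\beta)^T\mathbf S_\tau^T\in\mathbb C^{N_R\times N_t}$. Let $\Delta_\tau=\frac1{2B}$,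 $\Delta_\beta=\frac2{N_RN_T}$, and let $\mathbf A$ be the $N_RN_t\times N_\tau N_\beta$ matrix whose columns are the vectors $\operatorname{vec}\mathbf Z(m\Delta_\beta,n\Delta_\tau)$, $1\le n\le N_\tau$, $1\le m\le N_\beta$, where $N_\tau\le N_t$ and $N_\beta\le N_RN_T$ (so that the grid points lie within one period; the full grid is $N_\tau=N_t$, $N_\beta=N_RN_T$). Then there is a numerical constant $C>0$, independent of all the parameters above, such that $$\mathbb P\Bigl(\|\mathbf A\|_{\mathrm{op}}^2\ge N_tN_RN_T(1+\log N_t)\Bigr)\le N_t^{\,1-CN_T},$$ where $\|\mathbf A\|_{\mathrm{op}}$ is the largest singular value of $\mathbf A$. -/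

import Mathlib

open MeasureTheory ProbabilityTheory
open scoped NNReal Matrix.Norms.L2Operator

/-- The circularly symmetric complex Gaussian law `CN(0, v)`: real and imaginary parts are
independent centred real Gaussians of variance `v / 2`, so that `E |z|² = v`. -/
noncomputable def complexGaussian (v : ℝ≥0) : Measure ℂ :=
  ((gaussianReal 0 (v / 2)).prod (gaussianReal 0 (v / 2))).map
    Complex.measurableEquivRealProd.symm

/-- Array manifold of a uniform linear array with `N` elements and normalized spacing `d`:
the vector `(1, e^{j2πdβ}, …, e^{j2πdβ(N-1)})`. -/
noncomputable def arrayManifold (d : ℝ) (N : ℕ) (β : ℝ) : Fin N → ℂ :=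
  fun k => Complex.exp (((2 * Real.pi * d * β * (k : ℝ) : ℝ) : ℂ) * Complex.I)

/-- The `Nt × NT` matrix `S_τ` whose columns are the delayed signals `s_k(t - τ)`, sampled at
`t = l Δt`, `l = 1, …, Nt`. (The delay is circular because the signals will be periodic.) -/
noncomputable def delayedSamples {NT : ℕ} (Nt : ℕ) (Δt : ℝ) (s : Fin NT → ℝ → ℂ) (τ : ℝ) :
    Matrix (Fin Nt) (Fin NT) ℂ :=
  Matrix.of fun l k => s k (((l : ℝ) + 1) * Δt - τ)

/-- The `NR × Nt` noise-free received signal `Z(t; β, τ) = a_R(β) a_T(β)ᵀ S_τᵀ` of a unit strength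
target at direction `β` and delay `τ`. -/
noncomputable def receivedSignal {NT : ℕ} (NR Nt : ℕ) (dT dR Δt : ℝ) (s : Fin NT → ℝ → ℂ)
    (β τ : ℝ) : Matrix (Fin NR) (Fin Nt) ℂ :=
  Matrix.vecMulVec (arrayManifold dR NR β) (arrayManifold dT NT β) *
    (delayedSamples Nt Δt s τ).transpose

/-- The response matrix `A`: its columns are the vectorized received signals
`vec Z(t; β, τ)` for the grid points `τ = n Δτ`, `n = 1, …, Nτ`, and `β = m Δβ`, `m = 1, …, Nβ`.
Rows are indexed by pairs (receive antenna, time sample), columns by pairs (delay, azimuth). -/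
noncomputable def responseMatrix {NT : ℕ} (NR Nt Nτ Nβ : ℕ) (dT dR Δt Δτ Δβ : ℝ)
    (s : Fin NT → ℝ → ℂ) : Matrix (Fin NR × Fin Nt) (Fin Nτ × Fin Nβ) ℂ :=
  Matrix.of fun r c =>
    receivedSignal NR Nt dT dR Δt s (((c.2 : ℝ) + 1) * Δβ) (((c.1 : ℝ) + 1) * Δτ) r.1 r.2

/-- The transmit signals `s_1, …, s_NT` are periodic white Gaussian noise signals of period `T`:
their samples `s_k(l Δt)`, `l = 1, …, Nt`, over one period (`T = Nt Δt`) are independent and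
`CN(0, 1 / NT)`-distributed. -/
structure IsPeriodicWhiteGaussianNoise {Ω : Type*} [MeasurableSpace Ω] (μ : Measure Ω)
    (NT Nt : ℕ) (T Δt : ℝ) (s : Fin NT → ℝ → Ω → ℂ) : Prop where
  periodic : ∀ k t ω, s k (t + T) ω = s k t ω
  hasLaw : ∀ (k : Fin NT) (l : Fin Nt),
    HasLaw (s k (((l : ℝ) + 1) * Δt)) (complexGaussian ((NT : ℝ≥0)⁻¹)) μ
  indep : iIndepFun (fun (p : Fin NT × Fin Nt) => s p.1 (((p.2 : ℝ) + 1) * Δt)) μ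

/-! At the grid angles the two arrays act as one virtual array with `NR * NT` distinct Fourier
frequencies, and periodicity makes the delays circulant. Applying Parseval in angle and
diagonalizing in time bounds `‖A‖ ^ 2` by `NR * NT` times the largest value over `w` of `∑ k,
|ŝ_k(w)| ^ 2` (`norm_responseMatrix_sq_le`); this part is deterministic. For fixed `w`, the
coefficients `ŝ_k(w)` are independent `CN(0, Nt / NT)`, so a Chernoff bound controls their total
power (`measureReal_sum_normSq_ge_le`). A union bound over the `Nt` frequencies costs one factor
`Nt`. -/

/-! ### Fourier analysis on `ZMod N` and operator norms -/

/-- Parseval's identity for the characters of `ZMod N` indexed by distinct frequencies. -/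
theorem ZMod.sum_normSq_sum_stdAddChar_mul {N : ℕ} [NeZero N] {ι : Type*} [Fintype ι]
    {e : ι → ZMod N} (he : Function.Injective e) (y : ι → ℂ) :
    ∑ k, ‖∑ i, ZMod.stdAddChar (e i * k) * y i‖ ^ 2 = N * ∑ i, ‖y i‖ ^ 2 := by
  classical
  have horth : ∀ i j, ∑ k, ZMod.stdAddChar (k * (e i - e j)) = if i = j then (N : ℂ) else 0 := by
    intro i j
    rw [AddChar.sum_mulShift _ (ZMod.isPrimitive_stdAddChar N), ZMod.card]
    simp [sub_eq_zero, he.eq_iff]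
  have hconj : ∀ a : ZMod N, starRingEnd ℂ (ZMod.stdAddChar a) = ZMod.stdAddChar (-a) := by
    intro a
    rw [AddChar.map_neg_eq_conj]
  have hsq : ∀ z : ℂ, ((‖z‖ ^ 2 : ℝ) : ℂ) = z * starRingEnd ℂ z := by
    intro z
    rw [Complex.mul_conj, Complex.normSq_eq_norm_sq]
  apply Complex.ofReal_injective
  push_cast [← Complex.ofReal_pow, hsq]
  simp_rw [map_sum, map_mul, hconj, Finset.sum_mul_sum]
  rw [Finset.sum_comm, Finset.mul_sum]
  refine Finset.sum_congr rfl fun i _ => ?_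
  rw [Finset.sum_comm]
  have : ∀ j, ∑ k, ZMod.stdAddChar (e i * k) * y i * (ZMod.stdAddChar (-(e j * k)) *
      starRingEnd ℂ (y j)) = (if i = j then (N : ℂ) else 0) * (y i * starRingEnd ℂ (y j)) := by
    intro j
    rw [← horth, Finset.sum_mul]
    refine Finset.sum_congr rfl fun k _ => ?_
    rw [show k * (e i - e j) = e i * k + -(e j * k) by ring, AddChar.map_add_eq_mul]
    ring
  simp [this]

/-- The Fourier transform diagonalizes circular convolution. -/
theorem ZMod.sum_stdAddChar_mul_sum_sub {N : ℕ} [NeZero N] {ι : Type*} [Fintype ι]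
    (e : ι → ZMod N) (x : ι → ℂ) (g : ZMod N → ℂ) (w : ZMod N) :
    ∑ n, ZMod.stdAddChar (n * w) * ∑ l, g (e l - n) * x l =
      (∑ a, ZMod.stdAddChar (a * -w) * g a) * ∑ l, ZMod.stdAddChar (e l * w) * x l := by
  simp_rw [Finset.mul_sum]
  rw [Finset.sum_comm]
  refine Finset.sum_congr rfl fun l _ => ?_
  rw [Finset.sum_mul, ← (Equiv.subLeft (e l)).sum_comp]
  refine Finset.sum_congr rfl fun n _ => ?_
  rw [Equiv.subLeft_apply, sub_sub_cancel,
    show (e l - n) * w = n * -w + e l * w by ring, AddChar.map_add_eq_mul]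
  ring

/-- A family of circulant operators is bounded by the largest total power of its symbols. -/
theorem ZMod.sum_sum_normSq_circulant_le {N : ℕ} [NeZero N] {ι κ : Type*} [Fintype ι] [Fintype κ]
    {e : ι → ZMod N} (he : Function.Injective e) (x : ι → ℂ) (g : κ → ZMod N → ℂ) {M : ℝ}
    (hM : ∀ w, ∑ k, ‖∑ a, ZMod.stdAddChar (a * w) * g k a‖ ^ 2 ≤ M) :
    ∑ n, ∑ k, ‖∑ l, g k (e l - n) * x l‖ ^ 2 ≤ M * ∑ l, ‖x l‖ ^ 2 := by
  have hN : (0 : ℝ) < N := by exact_mod_cast NeZero.pos N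
  rw [Finset.sum_comm, ← mul_le_mul_iff_right₀ hN, Finset.mul_sum]
  have h : ∀ k, (N : ℝ) * ∑ n, ‖∑ l, g k (e l - n) * x l‖ ^ 2 =
      ∑ w, ‖∑ a, ZMod.stdAddChar (a * -w) * g k a‖ ^ 2 *
        ‖∑ l, ZMod.stdAddChar (e l * w) * x l‖ ^ 2 := by
    intro k
    rw [← ZMod.sum_normSq_sum_stdAddChar_mul Function.injective_id]
    simp_rw [id_eq, ZMod.sum_stdAddChar_mul_sum_sub, norm_mul, mul_pow]
  simp_rw [h]
  rw [Finset.sum_comm, mul_left_comm, ← ZMod.sum_normSq_sum_stdAddChar_mul he, Finset.mul_sum]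
  refine Finset.sum_le_sum fun w _ => ?_
  rw [← Finset.sum_mul]
  -- The summation variable `n` is subtracted in `g`, so the symbol appears at `-w`.
  exact mul_le_mul_of_nonneg_right (hM (-w)) (by positivity)

theorem Fintype.sum_comp_le_sum_of_injective {ι κ : Type*} [Fintype ι] [Fintype κ] {e : ι → κ}
    (he : Function.Injective e) {f : κ → ℝ} (hf : ∀ k, 0 ≤ f k) : ∑ i, f (e i) ≤ ∑ k, f k := by
  have h : ∑ i, f (e i) = ∑ k ∈ Finset.univ.map ⟨e, he⟩, f k := by simp
  rw [h]
  exact Finset.sum_le_sum_of_subset_of_nonneg (Finset.subset_univ _) fun k _ _ => hf k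

/-- A matrix and its adjoint have equal norm, and conjugating entries preserves Euclidean norms, so
testing the transpose suffices. -/
theorem Matrix.l2_opNorm_sq_le_of_vecMul_le {m n : Type*} [Fintype m] [Fintype n] [DecidableEq m]
    [DecidableEq n] (A : Matrix m n ℂ) {K : ℝ} (hK : 0 ≤ K)
    (h : ∀ y : m → ℂ, ∑ c, ‖∑ r, A r c * y r‖ ^ 2 ≤ K * ∑ r, ‖y r‖ ^ 2) : ‖A‖ ^ 2 ≤ K := by
  rw [← Matrix.l2_opNorm_conjTranspose]
  refine (Real.le_sqrt (norm_nonneg _) hK).1 ?_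
  rw [Matrix.l2_opNorm_def]
  refine ContinuousLinearMap.opNorm_le_bound _ (Real.sqrt_nonneg _) fun y => ?_
  rw [EuclideanSpace.norm_eq, EuclideanSpace.norm_eq, ← Real.sqrt_mul hK]
  apply Real.sqrt_le_sqrt
  have h1 := h fun r => starRingEnd ℂ (y r)
  simp only [RCLike.norm_conj] at h1
  refine le_trans (Finset.sum_le_sum fun c _ => ?_) h1
  have : starRingEnd ℂ (∑ r, A r c * starRingEnd ℂ (y r)) = (A.conjTranspose.mulVec y) c := by
    simp [Matrix.mulVec, dotProduct]
  rw [← RCLike.norm_conj (∑ r, A r c * starRingEnd ℂ (y r)), this]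
  rfl

theorem ZMod.injective_natCast_fin_add_one {N K : ℕ} (hK : K ≤ N) :
    Function.Injective fun i : Fin K => (((i : ℕ) + 1 : ℕ) : ZMod N) := by
  intro i j h
  have h1 := (ZMod.natCast_eq_natCast_iff _ _ _).1 h
  have h2 : (i : ℕ) ≡ j [MOD N] := Nat.ModEq.add_right_cancel' 1 h1
  exact Fin.ext (h2.eq_of_lt_of_lt (i.2.trans_le hK) (j.2.trans_le hK))

/-- A space-time matrix with Fourier structure in space (frequencies `d`) and circulant structure
in time. -/
theorem Matrix.l2_opNorm_sq_le_of_fourier_circulant {P N : ℕ} [NeZero P] [NeZero N]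
    {ρ κ τ ν β : Type*} [Fintype ρ] [Fintype κ] [Fintype τ] [Fintype ν] [Fintype β]
    [DecidableEq ρ] [DecidableEq τ] [DecidableEq ν] [DecidableEq β]
    {d : ρ × κ → ZMod P} (hd : Function.Injective d) {el : τ → ZMod N}
    (hel : Function.Injective el) {en : ν → ZMod N} (hen : Function.Injective en)
    {eb : β → ZMod P} (heb : Function.Injective eb) (g : κ → ZMod N → ℂ)
    {A : Matrix (ρ × τ) (ν × β) ℂ}
    (hA : ∀ j l n b, A (j, l) (n, b) =
      ∑ k, ZMod.stdAddChar (d (j, k) * eb b) * g k (el l - en n)) {M : ℝ} (hM0 : 0 ≤ M)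
    (hM : ∀ w, ∑ k, ‖∑ a, ZMod.stdAddChar (a * w) * g k a‖ ^ 2 ≤ M) :
    ‖A‖ ^ 2 ≤ P * M := by
  refine A.l2_opNorm_sq_le_of_vecMul_le (by positivity) fun y => ?_
  have hsum : ∀ n b, ∑ r, A r (n, b) * y r = ∑ p : ρ × κ, ZMod.stdAddChar (d p * eb b) *
      ∑ l, g p.2 (el l - en n) * y (p.1, l) := by
    intro n b
    rw [Fintype.sum_prod_type, Fintype.sum_prod_type]
    refine Finset.sum_congr rfl fun j _ => ?_
    simp_rw [hA, Finset.sum_mul, Finset.mul_sum]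
    rw [Finset.sum_comm]
    simp_rw [mul_assoc]
  calc ∑ c, ‖∑ r, A r c * y r‖ ^ 2
      = ∑ n, ∑ b, ‖∑ p : ρ × κ, ZMod.stdAddChar (d p * eb b) *
          ∑ l, g p.2 (el l - en n) * y (p.1, l)‖ ^ 2 := by
        rw [Fintype.sum_prod_type]
        simp_rw [hsum]
    -- A partial grid only omits nonnegative terms, so the sum over angles extends to all of `ZMod
    -- P`, where Parseval applies; the next step does the same for delays.
    _ ≤ ∑ n, P * ∑ p : ρ × κ, ‖∑ l, g p.2 (el l - en n) * y (p.1, l)‖ ^ 2 := by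
        refine Finset.sum_le_sum fun n _ => ?_
        rw [← ZMod.sum_normSq_sum_stdAddChar_mul hd]
        exact Fintype.sum_comp_le_sum_of_injective heb (f := fun b => ‖∑ p : ρ × κ,
          ZMod.stdAddChar (d p * b) * ∑ l, g p.2 (el l - en n) * y (p.1, l)‖ ^ 2)
          fun _ => by positivity
    _ ≤ ∑ n, P * ∑ p : ρ × κ, ‖∑ l, g p.2 (el l - n) * y (p.1, l)‖ ^ 2 :=
        Fintype.sum_comp_le_sum_of_injective hen (f := fun n => P * ∑ p : ρ × κ,
          ‖∑ l, g p.2 (el l - n) * y (p.1, l)‖ ^ 2) fun _ => by positivity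
    _ = P * ∑ j, ∑ n, ∑ k, ‖∑ l, g k (el l - n) * y (j, l)‖ ^ 2 := by
        rw [← Finset.mul_sum]
        simp_rw [Fintype.sum_prod_type]
        rw [Finset.sum_comm]
    _ ≤ P * ∑ j, M * ∑ l, ‖y (j, l)‖ ^ 2 := by
        gcongr with j
        exact ZMod.sum_sum_normSq_circulant_le hel _ g hM
    _ = P * M * ∑ r, ‖y r‖ ^ 2 := by
        rw [← Finset.mul_sum, mul_assoc, Fintype.sum_prod_type]

/-! ### Complex Gaussians and the Chernoff bound -/

instance (v : ℝ≥0) : IsProbabilityMeasure (complexGaussian v) :=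
  Measure.isProbabilityMeasure_map Complex.measurableEquivRealProd.symm.measurable.aemeasurable

theorem charFun_complexGaussian (v : ℝ≥0) (t : ℂ) :
    charFun (complexGaussian v) t = Complex.exp (-(v * ‖t‖ ^ 2 / 4 : ℝ)) := by
  rw [charFun_apply, complexGaussian,
    integral_map Complex.measurableEquivRealProd.symm.measurable.aemeasurable
      (Measurable.aestronglyMeasurable (by fun_prop))]
  have h : ∀ p : ℝ × ℝ,
      Complex.exp (inner ℝ (Complex.measurableEquivRealProd.symm p) t * Complex.I)
        = Complex.exp (t.re * p.1 * Complex.I) * Complex.exp (t.im * p.2 * Complex.I) := by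
    intro p
    rw [← Complex.exp_add]
    congr 1
    simp [Complex.inner, Complex.measurableEquivRealProd]
    ring
  simp_rw [h]
  rw [integral_prod_mul (fun x : ℝ => Complex.exp (t.re * x * Complex.I))
    (fun x : ℝ => Complex.exp (t.im * x * Complex.I)),
    ← charFun_apply_real, ← charFun_apply_real, charFun_gaussianReal, charFun_gaussianReal,
    ← Complex.exp_add, Complex.sq_norm, Complex.normSq_apply]
  congr 1
  push_cast
  ring

/-- The characteristic function depends only on `‖t‖`, so unimodular weights leave each law
unchanged; independence then adds the variances. -/
theorem ProbabilityTheory.iIndepFun.hasLaw_sum_complexGaussian {Ω ι : Type*} [Fintype ι]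
    [MeasurableSpace Ω] {μ : Measure Ω} {X : ι → Ω → ℂ} {v : ℝ≥0} {u : ι → ℂ}
    (hu : ∀ i, ‖u i‖ = 1) (hX : ∀ i, HasLaw (X i) (complexGaussian v) μ)
    (hind : iIndepFun X μ) :
    HasLaw (fun ω => ∑ i, u i * X i ω) (complexGaussian (Fintype.card ι * v)) μ := by
  have := hind.isProbabilityMeasure
  have hm : ∀ i, AEMeasurable (X i) μ := fun i => (hX i).aemeasurable
  have hm' : ∀ i, AEMeasurable (fun ω => u i * X i ω) μ := fun i => (hm i).const_mul _
  refine ⟨Finset.aemeasurable_fun_sum _ fun i _ => hm' i, ?_⟩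
  have hind' : iIndepFun (fun i ω => u i * X i ω) μ :=
    hind.comp (fun i z => u i * z) fun i => measurable_const_mul _
  apply Measure.ext_of_charFun
  rw [hind'.charFun_map_fun_sum_eq_prod hm']
  ext t
  have h : ∀ i, charFun (μ.map fun ω => u i * X i ω) t
      = Complex.exp (-(v * ‖t‖ ^ 2 / 4 : ℝ)) := by
    intro i
    have h1 : (μ.map fun ω => u i * X i ω) = (complexGaussian v).map (u i * ·) := by
      rw [← (hX i).map_eq, AEMeasurable.map_map_of_aemeasurable (by fun_prop) (hm i)]
      rfl
    have h2 : charFun ((complexGaussian v).map (u i * ·)) t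
        = charFun (complexGaussian v) (starRingEnd ℂ (u i) * t) := by
      rw [charFun_apply, charFun_apply, integral_map (by fun_prop)
        (Measurable.aestronglyMeasurable (by fun_prop))]
      congr 1
      ext z
      congr 3
      simp only [Complex.inner, map_mul]
      congr 1
      ring
    rw [h1, h2, charFun_complexGaussian]
    simp [hu]
  rw [Finset.prod_apply, Finset.prod_congr rfl fun i _ => h i, charFun_complexGaussian,
    Finset.prod_const, ← Complex.exp_nat_mul]
  congr 1
  push_cast [Finset.card_univ]
  ring

/-- No bound on `c` is needed: in the divergent case both sides take the default value `0`. -/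
theorem integral_exp_mul_sq_gaussianReal {v : ℝ≥0} (hv : v ≠ 0) {c : ℝ} :
    ∫ x, Real.exp (c * x ^ 2) ∂(gaussianReal 0 v) = (√(1 - 2 * c * v))⁻¹ := by
  have hv' : (0 : ℝ) < v := by positivity
  rw [integral_gaussianReal_eq_integral_smul hv]
  have h : ∀ x : ℝ, gaussianPDFReal 0 v x • Real.exp (c * x ^ 2)
      = (√(2 * Real.pi * v))⁻¹ * Real.exp (-((1 - 2 * c * v) / (2 * v)) * x ^ 2) := by
    intro x
    rw [gaussianPDFReal_def, smul_eq_mul, mul_assoc, ← Real.exp_add]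
    congr 2
    field_simp
    ring
  simp_rw [h]
  rw [integral_const_mul, integral_gaussian, ← Real.sqrt_inv, ← Real.sqrt_inv,
    ← Real.sqrt_mul (by positivity)]
  congr 1
  have h1 : (2 * Real.pi * (v : ℝ))⁻¹ * (Real.pi * (2 * v)) = 1 := by field_simp
  rw [div_div_eq_mul_div, ← mul_div_assoc, h1, one_div]

theorem mgf_normSq_complexGaussian {v : ℝ≥0} (hv : v ≠ 0) {c : ℝ} (hc : c * v ≤ 1) :
    mgf (fun z : ℂ => ‖z‖ ^ 2) (complexGaussian v) c = (1 - c * v)⁻¹ := by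
  rw [mgf, complexGaussian,
    integral_map Complex.measurableEquivRealProd.symm.measurable.aemeasurable
      (Measurable.aestronglyMeasurable (by fun_prop))]
  have h : ∀ p : ℝ × ℝ, Real.exp (c * ‖Complex.measurableEquivRealProd.symm p‖ ^ 2)
      = Real.exp (c * p.1 ^ 2) * Real.exp (c * p.2 ^ 2) := by
    intro p
    rw [← Real.exp_add, Complex.sq_norm, Complex.normSq_apply]
    simp [Complex.measurableEquivRealProd]
    ring
  simp_rw [h]
  have hv2 : v / 2 ≠ 0 := by positivity
  rw [integral_prod_mul (fun x : ℝ => Real.exp (c * x ^ 2)) (fun x : ℝ => Real.exp (c * x ^ 2)),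
    integral_exp_mul_sq_gaussianReal hv2, ← mul_inv, Real.mul_self_sqrt]
  · push_cast; congr 2; ring
  · push_cast; linarith

/-- Independence means that the joint law is a product measure, and currying turns it into the
product of the row laws. -/
theorem ProbabilityTheory.iIndepFun.curry {Ω ι κ E : Type*} [Finite ι] [Finite κ]
    [MeasurableSpace Ω] [MeasurableSpace E] {μ : Measure Ω} {X : ι × κ → Ω → E}
    (hm : ∀ p, AEMeasurable (X p) μ) (h : iIndepFun X μ) :
    iIndepFun (fun i ω j => X (i, j) ω) μ := by
  have := h.isProbabilityMeasure
  have : ∀ p, IsProbabilityMeasure (μ.map (X p)) := fun p => Measure.isProbabilityMeasure_map (hm p)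
  have hrow : ∀ i, μ.map (fun ω j => X (i, j) ω)
      = Measure.infinitePi fun j => μ.map (X (i, j)) := fun i =>
    (h.precomp (g := fun j => (i, j)) (Prod.mk_right_injective i)).map_fun_eq_infinitePi_map₀'
      fun j => hm (i, j)
  rw [iIndepFun_iff_map_fun_eq_infinitePi_map₀' fun i => aemeasurable_pi_iff.2 fun j => hm (i, j)]
  simp_rw [hrow]
  rw [← Measure.infinitePi_map_curry fun i j => μ.map (X (i, j))]
  have h2 := h.map_fun_eq_infinitePi_map₀' hm
  rw [← h2, AEMeasurable.map_map_of_aemeasurable (by fun_prop) (aemeasurable_pi_iff.2 hm)]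
  rfl

/-- Chernoff bound for a sum of `K` exponential variables of mean `v`. -/
theorem measureReal_sum_normSq_ge_le {Ω κ : Type*} [Fintype κ] [MeasurableSpace Ω]
    {μ : Measure Ω} {X : κ → Ω → ℂ} {v : ℝ≥0} (hv : v ≠ 0)
    (hX : ∀ k, HasLaw (X k) (complexGaussian v) μ) (hind : iIndepFun X μ) (a : ℝ) :
    μ.real {ω | a ≤ ∑ k, ‖X k ω‖ ^ 2} ≤
      Real.exp (-(a / (2 * v))) * 2 ^ Fintype.card κ := by
  have := hind.isProbabilityMeasure
  have hv' : (0 : ℝ) < v := by positivity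
  have hind' : iIndepFun (fun k ω => ‖X k ω‖ ^ 2) μ :=
    hind.comp (fun k z => ‖z‖ ^ 2) fun k => by fun_prop
  have hm : ∀ k, AEMeasurable (X k) μ := fun k => (hX k).aemeasurable
  have hm' : ∀ k, AEMeasurable (fun ω => ‖X k ω‖ ^ 2) μ := fun k => by
    have := hm k; fun_prop
  -- The Chernoff parameter is half the critical value `1 / v`, which makes each factor exactly `2`.
  have hk : ∀ k, mgf (fun ω => ‖X k ω‖ ^ 2) μ (1 / (2 * v)) = 2 := by
    intro k
    have h1 : mgf (fun z : ℂ => ‖z‖ ^ 2) (μ.map (X k)) (1 / (2 * v))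
        = mgf (fun ω => ‖X k ω‖ ^ 2) μ (1 / (2 * v)) :=
      mgf_map (hm k) (Measurable.aestronglyMeasurable (by fun_prop))
    have h2 : 1 / (2 * (v : ℝ)) * v = 1 / 2 := by field_simp
    rw [← h1, (hX k).map_eq, mgf_normSq_complexGaussian hv (by rw [h2]; norm_num), h2]
    norm_num
  have hsum : mgf (∑ k, fun ω => ‖X k ω‖ ^ 2) μ (1 / (2 * v)) = 2 ^ Fintype.card κ := by
    rw [hind'.mgf_sum₀ hm', Finset.prod_congr rfl fun k _ => hk k, Finset.prod_const,
      Finset.card_univ]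
  have h := measure_ge_le_exp_mul_mgf (μ := μ) (X := ∑ k, fun ω => ‖X k ω‖ ^ 2)
    (t := 1 / (2 * v)) a (by positivity)
    -- A nonintegrable function would have integral `0`.
    (Integrable.of_integral_ne_zero (by rw [← mgf, hsum]; positivity))
  rw [hsum] at h
  simp only [Finset.sum_apply] at h
  convert h using 3
  ring

/-! ### Periodic samples and the virtual array -/

theorem Function.Periodic.apply_val_intCast_mul {E : Type*} {f : ℝ → E} {N : ℕ} [NeZero N] {Δ : ℝ}
    (hf : Function.Periodic f (N * Δ)) (z : ℤ) :
    f ((z : ZMod N).val * Δ) = f (z * Δ) := by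
  have h1 : (((z : ZMod N).val : ℤ) : ℝ) = ((z % N : ℤ) : ℝ) := by
    rw [ZMod.val_intCast]
  have h2 : (z : ℝ) = ((z % N : ℤ) : ℝ) + N * ((z / N : ℤ) : ℝ) := by
    exact_mod_cast (Int.emod_add_mul_ediv z N).symm
  rw [Int.cast_natCast] at h1
  rw [h1, h2, show (((z % N : ℤ) : ℝ) + N * ((z / N : ℤ) : ℝ)) * Δ
    = ((z % N : ℤ) : ℝ) * Δ + ((z / N : ℤ) : ℝ) * (N * Δ) by ring]
  exact (hf.int_mul _ _).symm

theorem ZMod.stdAddChar_natCast_mul_natCast {N : ℕ} [NeZero N] (a b : ℕ) :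
    ZMod.stdAddChar ((a : ZMod N) * (b : ZMod N)) =
      Complex.exp (((2 * Real.pi * (a * b / N) : ℝ) : ℂ) * Complex.I) := by
  have h := ZMod.stdAddChar_coe (N := N) ((a * b : ℕ) : ℤ)
  push_cast at h ⊢
  rw [h]
  congr 1
  ring

theorem ZMod.injective_natCast_finProdFinEquiv {m n : ℕ} :
    Function.Injective fun p : Fin m × Fin n =>
      ((finProdFinEquiv p : ℕ) : ZMod (m * n)) := by
  intro p q h
  have h1 := (ZMod.natCast_eq_natCast_iff _ _ _).1 h
  exact finProdFinEquiv.injective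
    (Fin.ext (h1.eq_of_lt_of_lt (finProdFinEquiv p).2 (finProdFinEquiv q).2))

/-- The two arrays together form a virtual uniform array with `NR * NT` elements. -/
theorem exists_virtualArray {NR NT : ℕ} [NeZero (NR * NT)] {dT dR : ℝ}
    (hd : (dT = 1 / 2 ∧ dR = (NT : ℝ) / 2) ∨ (dT = (NR : ℝ) / 2 ∧ dR = 1 / 2)) :
    ∃ d : Fin NR × Fin NT → ZMod (NR * NT), Function.Injective d ∧ ∀ j k (m : ℕ),
      arrayManifold dR NR (((m : ℝ) + 1) * (2 / ((NR : ℝ) * NT))) j *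
        arrayManifold dT NT (((m : ℝ) + 1) * (2 / ((NR : ℝ) * NT))) k =
      ZMod.stdAddChar (d (j, k) * ((m + 1 : ℕ) : ZMod (NR * NT))) := by
  rcases hd with ⟨rfl, rfl⟩ | ⟨rfl, rfl⟩
  -- The phases add up to frequency `k + NT * j` here and `j + NR * k` in the other case, hence the
  -- swap there.
  · refine ⟨fun p => ((finProdFinEquiv p : ℕ) : ZMod (NR * NT)),
      ZMod.injective_natCast_finProdFinEquiv, fun j k m => ?_⟩
    rw [ZMod.stdAddChar_natCast_mul_natCast]
    simp only [arrayManifold, finProdFinEquiv_apply_val]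
    rw [← Complex.exp_add]
    congr 1
    push_cast
    ring
  · refine ⟨fun p => ((finProdFinEquiv p.swap : ℕ) : ZMod (NR * NT)), ?_, fun j k m => ?_⟩
    · rw [mul_comm NR NT]
      exact ZMod.injective_natCast_finProdFinEquiv.comp Prod.swap_injective
    rw [ZMod.stdAddChar_natCast_mul_natCast]
    simp only [arrayManifold, finProdFinEquiv_apply_val, Prod.swap_prod_mk]
    rw [← Complex.exp_add]
    congr 1
    push_cast
    ring

/-- The response matrix is bounded by the peak of the total power spectrum of the signals. -/
theorem norm_responseMatrix_sq_le {NR NT Nt Nτ Nβ : ℕ} [NeZero (NR * NT)] [NeZero Nt]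
    (hτ : Nτ ≤ Nt) (hβ : Nβ ≤ NR * NT) {dT dR Δ : ℝ}
    (hd : (dT = 1 / 2 ∧ dR = (NT : ℝ) / 2) ∨ (dT = (NR : ℝ) / 2 ∧ dR = 1 / 2))
    {s : Fin NT → ℝ → ℂ} (hs : ∀ k, Function.Periodic (s k) (Nt * Δ)) {M : ℝ} (hM0 : 0 ≤ M)
    (hM : ∀ w : ZMod Nt, ∑ k, ‖∑ l : Fin Nt,
      ZMod.stdAddChar (((l + 1 : ℕ) : ZMod Nt) * w) * s k (((l : ℝ) + 1) * Δ)‖ ^ 2 ≤ M) :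
    ‖responseMatrix NR Nt Nτ Nβ dT dR Δ Δ (2 / ((NR : ℝ) * NT)) s‖ ^ 2 ≤ NR * NT * M := by
  obtain ⟨d, hdinj, hdeq⟩ := exists_virtualArray hd
  have hl := ZMod.injective_natCast_fin_add_one (le_refl Nt)
  have hbij : Function.Bijective fun i : Fin Nt => (((i : ℕ) + 1 : ℕ) : ZMod Nt) :=
    (Fintype.bijective_iff_injective_and_card _).2 ⟨hl, by simp [ZMod.card]⟩
  have hg : ∀ k (z : ℤ), s k ((z : ZMod Nt).val * Δ) = s k (z * Δ) := fun k z =>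
    (hs k).apply_val_intCast_mul z
  have hnorm := Matrix.l2_opNorm_sq_le_of_fourier_circulant hdinj hl
    (ZMod.injective_natCast_fin_add_one hτ) (ZMod.injective_natCast_fin_add_one hβ)
    (fun k a => s k (a.val * Δ))
    (A := responseMatrix NR Nt Nτ Nβ dT dR Δ Δ (2 / ((NR : ℝ) * NT)) s) ?_ hM0 ?_
  · exact_mod_cast hnorm
  · intro j l n b
    simp only [responseMatrix, receivedSignal, delayedSamples, Matrix.of_apply, Matrix.mul_apply,
      Matrix.vecMulVec_apply, Matrix.transpose_apply, hdeq]
    refine Finset.sum_congr rfl fun k _ => ?_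
    have := hg k (((l : ℕ) + 1 : ℕ) - ((n : ℕ) + 1 : ℕ))
    rw [Int.cast_sub, Int.cast_natCast, Int.cast_natCast] at this
    rw [this]
    congr 2
    push_cast
    ring
  · intro w
    convert hM w using 4 with k
    rw [← hbij.sum_comp]
    congr 2 with l
    have := hg k ((l : ℕ) + 1 : ℕ)
    rw [Int.cast_natCast] at this
    rw [this]
    push_cast
    rfl

/-! ### Tail of the spectrum and union bound -/

/-- The worst case is `N = 2`, where a rate `C` in place of `1 / 5` requires `(1 / 2 + C) * log 2 ≤
1 / 2`, that is, `C` up to about `0.221`. -/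
theorem chernoff_exponent_le {N : ℕ} (hN : 2 ≤ N) (K : ℕ) :
    (N : ℝ) * (Real.exp (-(K * (1 + Real.log N) / 2)) * 2 ^ K) ≤
      (N : ℝ) ^ (1 - 1 / 5 * (K : ℝ)) := by
  have hN0 : (0 : ℝ) < N := by positivity
  have h2 : (2 : ℝ) ^ K = Real.exp (Real.log 2 * K) := by
    rw [← Real.rpow_natCast, Real.rpow_def_of_pos two_pos]
  rw [Real.rpow_def_of_pos hN0, h2]
  nth_rewrite 1 [← Real.exp_log hN0]
  rw [← Real.exp_add, ← Real.exp_add, Real.exp_le_exp]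
  have h3 : Real.log 2 ≤ Real.log N := Real.log_le_log two_pos (by exact_mod_cast hN)
  have h4 := Real.log_two_lt_d9
  have h5 : (K : ℝ) * (Real.log 2 - 1 / 2 - 3 / 10 * Real.log N) ≤ 0 :=
    mul_nonpos_of_nonneg_of_nonpos (by positivity) (by linarith)
  linarith

theorem IsPeriodicWhiteGaussianNoise.measureReal_spectrum_ge_le {Ω : Type*} [MeasurableSpace Ω]
    {μ : Measure Ω} {NT Nt : ℕ} {T Δ : ℝ} {s : Fin NT → ℝ → Ω → ℂ}
    (h : IsPeriodicWhiteGaussianNoise μ NT Nt T Δ s) (hNT : 0 < NT) [NeZero Nt] (w : ZMod Nt) :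
    μ.real {ω | (Nt : ℝ) * (1 + Real.log Nt) ≤ ∑ k, ‖∑ l : Fin Nt,
      ZMod.stdAddChar (((l + 1 : ℕ) : ZMod Nt) * w) * s k (((l : ℝ) + 1) * Δ) ω‖ ^ 2} ≤
      Real.exp (-(NT * (1 + Real.log Nt) / 2)) * 2 ^ NT := by
  have hNt : (Nt : ℝ≥0) ≠ 0 := by exact_mod_cast NeZero.ne Nt
  have hNT0 : (NT : ℝ≥0) ≠ 0 := by exact_mod_cast hNT.ne'
  have hu : ∀ l : Fin Nt, ‖(ZMod.stdAddChar (((l + 1 : ℕ) : ZMod Nt) * w) : ℂ)‖ = 1 := fun l => by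
    rw [ZMod.stdAddChar_apply]; exact Circle.norm_coe _
  have hm : ∀ p : Fin NT × Fin Nt, AEMeasurable (s p.1 (((p.2 : ℝ) + 1) * Δ)) μ := fun p =>
    (h.hasLaw p.1 p.2).aemeasurable
  have hlaw : ∀ k, HasLaw (fun ω => ∑ l : Fin Nt, ZMod.stdAddChar (((l + 1 : ℕ) : ZMod Nt) * w) *
      s k (((l : ℝ) + 1) * Δ) ω) (complexGaussian (Nt * (NT : ℝ≥0)⁻¹)) μ := fun k => by
    simpa using (h.indep.precomp (g := fun l => (k, l)) (Prod.mk_right_injective k)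
      ).hasLaw_sum_complexGaussian hu (h.hasLaw k)
  have hind : iIndepFun (fun k ω => ∑ l : Fin Nt, ZMod.stdAddChar (((l + 1 : ℕ) : ZMod Nt) * w) *
      s k (((l : ℝ) + 1) * Δ) ω) μ :=
    (h.indep.curry hm).comp (fun _ x => ∑ l : Fin Nt,
      ZMod.stdAddChar (((l + 1 : ℕ) : ZMod Nt) * w) * x l) fun _ => by fun_prop
  have hb := measureReal_sum_normSq_ge_le (mul_ne_zero hNt (inv_ne_zero hNT0)) hlaw hind
    ((Nt : ℝ) * (1 + Real.log Nt))
  rw [Fintype.card_fin] at hb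
  refine hb.trans_eq ?_
  have hNt' : (Nt : ℝ) ≠ 0 := by exact_mod_cast NeZero.ne Nt
  have hNT' : (NT : ℝ) ≠ 0 := by exact_mod_cast hNT.ne'
  congr 3
  push_cast
  field_simp

theorem mainTheorem3 :
    ∃ C : ℝ, 0 < C ∧
      ∀ (Nt NR NT Nτ Nβ : ℕ) (T B Δt Δτ Δβ dT dR : ℝ)
        (Ω : Type*) [MeasurableSpace Ω] (μ : Measure Ω) [IsProbabilityMeasure μ]
        (s : Fin NT → ℝ → Ω → ℂ),
        0 < Nt → 0 < NR → 0 < NT → Nτ ≤ Nt → Nβ ≤ NR * NT →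
        0 < B → Δt = 1 / (2 * B) → (Nt : ℝ) = T / Δt →
        Δτ = 1 / (2 * B) → Δβ = 2 / ((NR : ℝ) * NT) →
        ((dT = 1 / 2 ∧ dR = (NT : ℝ) / 2) ∨ (dT = (NR : ℝ) / 2 ∧ dR = 1 / 2)) →
        IsPeriodicWhiteGaussianNoise μ NT Nt T Δt s →
        -- the norm below is the operator norm, i.e. the largest singular value
        μ.real {ω | (Nt : ℝ) * NR * NT * (1 + Real.log Nt) ≤
            ‖responseMatrix NR Nt Nτ Nβ dT dR Δt Δτ Δβ (fun k t => s k t ω)‖ ^ 2} ≤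
          (Nt : ℝ) ^ (1 - C * (NT : ℝ)) := by
  refine ⟨1 / 5, by norm_num, ?_⟩
  intro Nt NR NT Nτ Nβ T B Δt Δτ Δβ dT dR Ω _ μ _ s hNt hNR hNT hτ hβ hB hΔt hT hΔτ hΔβ hd hs
  obtain rfl | hNt2 : Nt = 1 ∨ 2 ≤ Nt := by omega
  -- For `Nt = 1` the right side is `1`.
  · simp
  have : NeZero Nt := ⟨hNt.ne'⟩
  have : NeZero (NR * NT) := ⟨(Nat.mul_pos hNR hNT).ne'⟩
  have hΔ0 : Δt ≠ 0 := by rw [hΔt]; positivity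
  obtain rfl : Δτ = Δt := hΔτ.trans hΔt.symm
  have hT' : T = Nt * Δτ := by rw [hT]; field_simp
  subst hΔβ
  let S : ZMod Nt → Ω → ℝ := fun w ω => ∑ k, ‖∑ l : Fin Nt,
    ZMod.stdAddChar (((l + 1 : ℕ) : ZMod Nt) * w) * s k (((l : ℝ) + 1) * Δτ) ω‖ ^ 2
  have hP : (0 : ℝ) < NR * NT := by positivity
  have hsub : {ω | (Nt : ℝ) * NR * NT * (1 + Real.log Nt) ≤
      ‖responseMatrix NR Nt Nτ Nβ dT dR Δτ Δτ (2 / ((NR : ℝ) * NT)) (fun k t => s k t ω)‖ ^ 2} ⊆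
      ⋃ w, {ω | (Nt : ℝ) * (1 + Real.log Nt) ≤ S w ω} := by
    intro ω hω
    -- The peak frequency depends on `ω`, hence the union over all `w`.
    obtain ⟨w, hw⟩ := Finite.exists_max fun w => S w ω
    have hbound := norm_responseMatrix_sq_le (M := S w ω) hτ hβ hd
      (s := fun k t => s k t ω) (Δ := Δτ) (fun k t => by rw [← hT']; exact hs.periodic k t ω)
      (Finset.sum_nonneg fun _ _ => by positivity) hw
    refine Set.mem_iUnion.2 ⟨w, ?_⟩
    have h1 := hω.trans hbound
    rw [show (Nt : ℝ) * NR * NT * (1 + Real.log Nt)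
      = NR * NT * (Nt * (1 + Real.log Nt)) by ring] at h1
    exact le_of_mul_le_mul_left h1 hP
  calc _ ≤ μ.real (⋃ w, {ω | (Nt : ℝ) * (1 + Real.log Nt) ≤ S w ω}) :=
        measureReal_mono hsub (measure_ne_top _ _)
    _ ≤ ∑ w, μ.real {ω | (Nt : ℝ) * (1 + Real.log Nt) ≤ S w ω} := measureReal_iUnion_fintype_le _
    _ ≤ ∑ _w : ZMod Nt, Real.exp (-(NT * (1 + Real.log Nt) / 2)) * 2 ^ NT :=
        Finset.sum_le_sum fun w _ => hs.measureReal_spectrum_ge_le hNT w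
    _ = Nt * (Real.exp (-(NT * (1 + Real.log Nt) / 2)) * 2 ^ NT) := by
        rw [Finset.sum_const, Finset.card_univ, ZMod.card, nsmul_eq_mul]
    _ ≤ _ := chernoff_exponent_le hNt2 NT
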